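/- Let $d \ge 1$ be an integer and let $G = (V,E)$ be a finite simple graph. Call $G$ $k$-connected if $|V| \ge k+1$ and $G - S$ is connected for every $S \subseteq V$ with $|S| < k$. A map $p : V \to \mathbb{R}^d$ is generic if its $d|V|$ coordinates are algebraically independent over $\mathbb{Q}$. The framework $(G,p)$ is rigid if there is $\varepsilon > 0$ such that every $q : V \to \mathbb{R}^d$ with $\|p(u)-p(v)\| = \|q(u)-q(v)\|$ for all $uv \in E$ and $\|p(v)-q(v)\| < \varepsilon$ for all $v \in V$ satisfies $\|p(u)-p(v)\| = \|q(u)-q(v)\|$ for all $u,v \in V$. The graph $G$ is rigid in $\mathbb{R}^d$ if $(G,p)$ is rigid for every generic $p : V \to \mathbb{R}^d$. Theorem. Every $d(d+1)$-connected graph is rigid in $\mathbb{R}^d$. -/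

import Mathlib

namespace GraphRigidity

/-- A graph on a finite vertex set is `k`-connected if it has at least `k + 1` vertices and it
remains connected whenever fewer than `k` vertices are deleted. -/
def IsKConnected {V : Type*} [Fintype V] (G : SimpleGraph V) (k : ℕ) : Prop :=
  k + 1 ≤ Fintype.card V ∧
    ∀ S : Finset V, S.card < k → (G.induce ((S : Set V)ᶜ)).Connected

/-- The frameworks `(G, p)` and `(G, q)` are equivalent: corresponding edges have equal length. -/
def Equivalent {V : Type*} {d : ℕ} (G : SimpleGraph V)
    (p q : V → EuclideanSpace ℝ (Fin d)) : Prop :=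
  ∀ u v : V, G.Adj u v → ‖p u - p v‖ = ‖q u - q v‖

/-- `p` and `q` are congruent: all pairs of vertices have the same distance in both. -/
def Congruent {V : Type*} {d : ℕ} (p q : V → EuclideanSpace ℝ (Fin d)) : Prop :=
  ∀ u v : V, ‖p u - p v‖ = ‖q u - q v‖

/-- The framework `(G, p)` is rigid: every equivalent framework that is close enough to it is
congruent to it. -/
def IsRigidFramework {V : Type*} {d : ℕ} (G : SimpleGraph V)
    (p : V → EuclideanSpace ℝ (Fin d)) : Prop :=
  ∃ ε : ℝ, 0 < ε ∧ ∀ q : V → EuclideanSpace ℝ (Fin d),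
    Equivalent G p q → (∀ v : V, ‖p v - q v‖ < ε) → Congruent p q

/-- `p` is generic: its `d * |V|` coordinates are algebraically independent over `ℚ`. -/
def IsGeneric {V : Type*} {d : ℕ} (p : V → EuclideanSpace ℝ (Fin d)) : Prop :=
  AlgebraicIndependent ℚ (fun x : V × Fin d => p x.1 x.2)

/-- Generic frameworks exist, so that rigidity of a graph, defined next, is never vacuous. -/
theorem exists_isGeneric (V : Type*) [Finite V] (d : ℕ) :
    ∃ p : V → EuclideanSpace ℝ (Fin d), IsGeneric p := by
  obtain ⟨s, hs⟩ := exists_isTranscendenceBasis ℚ ℝ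
  have hinf : Infinite s := by
    by_contra hfin
    rw [not_infinite_iff_finite] at hfin
    have h1 : Countable s := inferInstance
    have : Algebra.IsAlgebraic (Algebra.adjoin ℚ (Set.range ((↑) : s → ℝ))) ℝ := hs.isAlgebraic
    have h2 := Algebra.IsAlgebraic.cardinalMk_le_max
      (Algebra.adjoin ℚ (Set.range ((↑) : s → ℝ))) ℝ
    have h3 : Cardinal.mk (Algebra.adjoin ℚ (Set.range ((↑) : s → ℝ))) ≤ Cardinal.aleph0 := by
      have e := hs.1.aevalEquiv
      rw [← Cardinal.mk_congr e.toEquiv]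
      refine MvPolynomial.cardinalMk_le_max.trans ?_
      simp
    rw [max_eq_right h3, Cardinal.mk_real] at h2
    exact absurd h2 (not_le.2 Cardinal.aleph0_lt_continuum)
  obtain ⟨f⟩ : Nonempty (V × Fin d ↪ s) := by
    obtain ⟨n, ⟨e⟩⟩ := Finite.exists_equiv_fin (V × Fin d)
    exact ⟨e.toEmbedding.trans (Fin.valEmbedding.trans (Infinite.natEmbedding s))⟩
  exact ⟨fun v => WithLp.toLp 2 fun i => f (v, i), hs.1.comp f f.injective⟩

/-- `G` is rigid in `ℝ^d`: every generic `d`-dimensional framework of `G` is rigid. -/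
def IsRigid {V : Type*} (G : SimpleGraph V) (d : ℕ) : Prop :=
  ∀ p : V → EuclideanSpace ℝ (Fin d), IsGeneric p → IsRigidFramework G p

end GraphRigidity

/-!
Fix a generic configuration `p` and consider the rows of its rigidity matrix.

*From rows to rigidity.* If the rows of the edges span the rows of all pairs, the framework is
rigid: for an equivalent `q` close to `p`, the displacement `q - p` is orthogonal to the rows of the
edges at the midpoint `m` of `p` and `q`, since `|a|² - |b|² = (a - b) · (a + b)`. Near `p` a basis
of rows stays independent, and no configuration has larger rank than a generic one, so at `m` the
edges still span the rows of all pairs, and `q` is congruent to `p`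
(`isRigidFramework_of_row_mem_rowSpan`). Genericity enters through Gram determinants, which are
rational polynomials in the coordinates (`linearIndependent_aeval_of_generic`).

*Reduction.* Replace `G` by the graph of all pairs whose rows lie in the span of its edges; the
claim is that it is complete. In this graph two vertices with `d` common neighbours forming a clique
are adjacent, by the self-stress of `d + 2` points (`row_mem_rowSpan_of_common_clique`). Deleting a
simplicial vertex keeps the connectivity, and completeness can be pulled back along the deletion.
So it suffices to exclude a graph with minimum degree at least `d * (d + 1)` in which no
neighbourhood is a clique.

*Counting.* Build the graph up vertex by vertex in a random order. A vertex with `j` earlier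
neighbours raises the rank by at least `min d j`, and by at least `d + 1` if there are more than `d`
earlier neighbours that do not form a clique (`rigidityRank_add_gain_le`, by `0`- and
`1`-extensions). If the neighbourhood of a vertex is not a clique, the merging property bounds the
number of cliques in it, and the expected increase is at least `d + 1/2 - d (d + 1) / (2 D)`, where
`D` is the degree; for `D ≥ d (d + 1)` this is at least `d`. The expectation is handled through the
recursion that conditions on the last vertex (`card_add_one_mul_meanGain_le`, `sum_meanGain_le`).
Hence the rank is at least `d` times the number of vertices, but it is smaller than that because
translations are in the kernel (`rigidityRank_lt`).
-/

namespace GraphRigidity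

/-! ### Generic points -/

/-- Vectors with rational polynomial entries that are linearly independent at one point are
linearly independent at every generic point: the Gram determinant is a rational polynomial. -/
theorem linearIndependent_aeval_of_generic {ι κ σ : Type*} [Finite ι] [Fintype κ]
    (P : ι → κ → MvPolynomial σ ℚ) {p q : σ → ℝ} (hp : AlgebraicIndependent ℚ p)
    (hq : LinearIndependent ℝ fun i k => MvPolynomial.aeval q (P i k)) :
    LinearIndependent ℝ fun i k => MvPolynomial.aeval p (P i k) := by
  classical
  have := Fintype.ofFinite ι
  let D : MvPolynomial σ ℚ := (Matrix.of fun i j => ∑ k, P i k * P j k).det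
  have key : ∀ x : σ → ℝ, MvPolynomial.aeval x D ≠ 0 ↔
      LinearIndependent ℝ fun i k => MvPolynomial.aeval x (P i k) := by
    intro x
    let e := (WithLp.linearEquiv 2 ℝ (κ → ℝ)).symm
    let f : ι → EuclideanSpace ℝ κ := fun i => e fun k => MvPolynomial.aeval x (P i k)
    have h1 : (Matrix.gram ℝ f).det = MvPolynomial.aeval x D := by
      rw [AlgHom.map_det]
      congr 1
      ext i j
      simp [Matrix.gram, f, e, PiLp.inner_apply, mul_comm]
    rw [← h1, Matrix.det_gram_ne_zero_iff_linearIndependent]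
    exact e.toLinearMap.linearIndependent_iff e.ker
  rw [← key] at hq ⊢
  intro h0
  exact hq (by rw [hp.eq_zero_of_aeval_eq_zero _ h0, map_zero])

/-- Generic points are in general position: the differences from `v` to at most `d` other points
are linearly independent. -/
theorem linearIndependent_sub_of_generic {V : Type*} {d : ℕ} {p : V → Fin d → ℝ}
    (hp : AlgebraicIndependent ℚ fun x : V × Fin d => p x.1 x.2) {A : Finset V} {v : V}
    (hv : v ∉ A) (hA : A.card ≤ d) : LinearIndependent ℝ fun u : A => p u - p v := by
  classical
  obtain ⟨f⟩ : Nonempty (A ↪ Fin d) :=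
    Function.Embedding.nonempty_of_card_le (by simpa using hA)
  -- The special position: `v` at the origin and the points of `A` at distinct basis vectors.
  let q : V × Fin d → ℝ := fun x =>
    if h : x.1 ∈ A then (Pi.single (f ⟨x.1, h⟩) 1 : Fin d → ℝ) x.2 else 0
  have := linearIndependent_aeval_of_generic (ι := A) (κ := Fin d) (q := q)
    (fun u i => MvPolynomial.X (u.1, i) - MvPolynomial.X (v, i)) hp (by
      have h := (Pi.basisFun ℝ (Fin d)).linearIndependent.comp f f.injective
      convert h using 1
      ext u i
      simp [q, hv])
  convert this using 1
  ext u i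
  simp

/-! ### The rigidity matrix and its generic rank -/

/-- The row of the rigidity matrix of the configuration `p` that belongs to the pair `x, y`: it has
`p x - p y` in the columns of `x`, `p y - p x` in those of `y`, and zeros elsewhere. For `x = y`
it is zero. -/
def row {V : Type*} [DecidableEq V] {d : ℕ} (p : V → Fin d → ℝ) (x y : V) : V → Fin d → ℝ :=
  Pi.single x (p x - p y) + Pi.single y (p y - p x)

/-- The span of the rows of the rigidity matrix that belong to a set `F` of ordered pairs. -/
def rowSpan {V : Type*} [DecidableEq V] {d : ℕ} (p : V → Fin d → ℝ) (F : Set (V × V)) :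
    Submodule ℝ (V → Fin d → ℝ) :=
  Submodule.span ℝ ((fun e : V × V => row p e.1 e.2) '' F)

/-- The edges of the subgraph of `G` induced by `S`, as ordered pairs. -/
def edgesIn {V : Type*} (G : SimpleGraph V) (S : Finset V) : Set (V × V) :=
  {e | e.1 ∈ S ∧ e.2 ∈ S ∧ G.Adj e.1 e.2}

/-- The rank of the rigidity matrix of the subframework of `(G, p)` induced by `S`. -/
noncomputable def rigidityRank {V : Type*} [DecidableEq V] {d : ℕ} (G : SimpleGraph V)
    (p : V → Fin d → ℝ) (S : Finset V) : ℕ :=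
  Module.finrank ℝ (rowSpan p (edgesIn G S))

section

variable {V : Type*} [DecidableEq V] {d : ℕ}

theorem row_comm (p : V → Fin d → ℝ) (x y : V) : row p x y = row p y x := by
  simp [row, add_comm]

theorem row_self (p : V → Fin d → ℝ) (x : V) : row p x x = 0 := by
  simp [row]

theorem row_apply_of_ne (p : V → Fin d → ℝ) {x y v : V} (hx : v ≠ x) (hy : v ≠ y) :
    row p x y v = 0 := by
  simp [row, hx, hy]

theorem row_apply_left (p : V → Fin d → ℝ) {x y : V} (h : x ≠ y) : row p x y x = p x - p y := by
  simp [row, h]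

theorem row_mem_rowSpan (p : V → Fin d → ℝ) {F : Set (V × V)} {x y : V} (h : (x, y) ∈ F) :
    row p x y ∈ rowSpan p F :=
  Submodule.subset_span ⟨(x, y), h, rfl⟩

theorem rowSpan_le {p : V → Fin d → ℝ} {F : Set (V × V)} {U : Submodule ℝ (V → Fin d → ℝ)} :
    rowSpan p F ≤ U ↔ ∀ x y, (x, y) ∈ F → row p x y ∈ U := by
  rw [rowSpan, Submodule.span_le, Set.image_subset_iff]
  exact ⟨fun h x y hxy => h hxy, fun h e he => h e.1 e.2 he⟩

theorem rowSpan_mono (p : V → Fin d → ℝ) {F F' : Set (V × V)} (h : F ⊆ F') :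
    rowSpan p F ≤ rowSpan p F' :=
  Submodule.span_mono (Set.image_mono h)


theorem rowSpan_edgesIn_le_ker_proj (G : SimpleGraph V) (p : V → Fin d → ℝ) {S : Finset V} {v : V}
    (hv : v ∉ S) :
    rowSpan p (edgesIn G S) ≤ (LinearMap.proj v : (V → Fin d → ℝ) →ₗ[ℝ] Fin d → ℝ).ker := by
  rw [rowSpan_le]
  rintro x y ⟨hx, hy, -⟩
  exact row_apply_of_ne p (by rintro rfl; exact hv hx) (by rintro rfl; exact hv hy)

variable [Fintype V]

theorem linearIndependent_row_of_generic {ι : Type*} [Finite ι] (e : ι → V × V)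
    {p q : V → Fin d → ℝ} (hp : AlgebraicIndependent ℚ fun x : V × Fin d => p x.1 x.2)
    (hq : LinearIndependent ℝ fun i => row q (e i).1 (e i).2) :
    LinearIndependent ℝ fun i => row p (e i).1 (e i).2 := by
  let P : ι → V × Fin d → MvPolynomial (V × Fin d) ℚ := fun i k =>
    (if k.1 = (e i).1 then MvPolynomial.X ((e i).1, k.2) - MvPolynomial.X ((e i).2, k.2) else 0) +
    (if k.1 = (e i).2 then MvPolynomial.X ((e i).2, k.2) - MvPolynomial.X ((e i).1, k.2) else 0)
  have hP : ∀ (r : V → Fin d → ℝ) i k,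
      MvPolynomial.aeval (fun x : V × Fin d => r x.1 x.2) (P i k) =
        row r (e i).1 (e i).2 k.1 k.2 := by
    intro r i k
    simp only [P, row, map_add, apply_ite (MvPolynomial.aeval _), map_sub, MvPolynomial.aeval_X,
      map_zero, Pi.add_apply, Pi.single_apply]
    split_ifs <;> simp
  have key : ∀ r : V → Fin d → ℝ, (LinearIndependent ℝ fun i => row r (e i).1 (e i).2) ↔
      LinearIndependent ℝ fun i k =>
        MvPolynomial.aeval (fun x : V × Fin d => r x.1 x.2) (P i k) := by
    intro r
    let L := LinearEquiv.curry ℝ ℝ V (Fin d)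
    have h1 : (fun i => row r (e i).1 (e i).2) = L.toLinearMap ∘ fun i k =>
        MvPolynomial.aeval (fun x : V × Fin d => r x.1 x.2) (P i k) := by
      funext i v j
      exact (hP r i (v, j)).symm
    rw [h1]
    exact LinearMap.linearIndependent_iff L.toLinearMap L.ker
  rw [key] at hq ⊢
  exact linearIndependent_aeval_of_generic P hp hq

/-- The rank of a set of rows is largest at generic configurations. -/
theorem finrank_rowSpan_le_of_generic {p : V → Fin d → ℝ}
    (hp : AlgebraicIndependent ℚ fun x : V × Fin d => p x.1 x.2) (q : V → Fin d → ℝ)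
    (F : Set (V × V)) : Module.finrank ℝ (rowSpan q F) ≤ Module.finrank ℝ (rowSpan p F) := by
  obtain ⟨κ, a, ha, hspan, hli⟩ :=
    exists_linearIndependent' ℝ fun e : F => row q e.1.1 e.1.2
  have : Finite κ := Finite.of_injective a ha
  have := Fintype.ofFinite κ
  have hli' := linearIndependent_row_of_generic (fun k => (a k).1) hp hli
  have h1 : rowSpan q F = Submodule.span ℝ (Set.range ((fun e : F => row q e.1.1 e.1.2) ∘ a)) := by
    rw [hspan, rowSpan, Set.image_eq_range]
  rw [h1, finrank_span_eq_card hli, ← finrank_span_eq_card hli']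
  refine Submodule.finrank_mono (Submodule.span_mono ?_)
  rintro _ ⟨k, rfl⟩
  exact ⟨(a k).1, (a k).2, rfl⟩

/-! ### Bounds for the rank -/

theorem finrank_add_finrank_map_le {E E' : Type*} [AddCommGroup E] [Module ℝ E]
    [FiniteDimensional ℝ E] [AddCommGroup E'] [Module ℝ E'] (f : E →ₗ[ℝ] E')
    {U U' : Submodule ℝ E} (h : U ≤ U') (hf : U ≤ f.ker) :
    Module.finrank ℝ U + Module.finrank ℝ (U'.map f) ≤ Module.finrank ℝ U' := by
  have h1 := (f.domRestrict U').finrank_range_add_finrank_ker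
  rw [LinearMap.range_domRestrict] at h1
  have h2 : U.comap U'.subtype ≤ (f.domRestrict U').ker := fun x hx => hf hx
  have h3 := Submodule.finrank_mono h2
  rw [(Submodule.comapSubtypeEquivOfLe h).finrank_eq] at h3
  omega

/-- Adding a vertex with at least `m ≤ d` neighbours raises the rank by at least `m`. -/
theorem rigidityRank_add_card_le (G : SimpleGraph V) {p : V → Fin d → ℝ}
    (hp : AlgebraicIndependent ℚ fun x : V × Fin d => p x.1 x.2) {S N : Finset V} {v : V}
    (hv : v ∉ S) (hNS : N ⊆ S) (hadj : ∀ u ∈ N, G.Adj v u) (hN : N.card ≤ d) :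
    rigidityRank G p S + N.card ≤ rigidityRank G p (insert v S) := by
  have hvN : v ∉ N := fun h => hv (hNS h)
  have hli := linearIndependent_sub_of_generic hp hvN hN
  refine le_trans ?_ (finrank_add_finrank_map_le
    (LinearMap.proj v : (V → Fin d → ℝ) →ₗ[ℝ] Fin d → ℝ)
    (rowSpan_mono p ?_) (rowSpan_edgesIn_le_ker_proj G p hv))
  · refine Nat.add_le_add_left ?_ _
    have h := finrank_span_eq_card hli
    rw [Fintype.card_coe] at h
    rw [← h]
    refine Submodule.finrank_mono (Submodule.span_le.2 ?_)
    rintro _ ⟨u, rfl⟩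
    have hne : (u : V) ≠ v := fun h => hvN (h ▸ u.2)
    refine ⟨-row p v u, neg_mem (row_mem_rowSpan p ⟨by simp, by simp [hNS u.2], hadj u u.2⟩), ?_⟩
    simp [row_apply_left p hne.symm]
  · rintro e ⟨h1, h2, h3⟩
    exact ⟨Finset.mem_insert_of_mem h1, Finset.mem_insert_of_mem h2, h3⟩

/-- Adding a vertex with `d + 1` neighbours, two of which are not joined by a row in the span of
the old rows, raises the rank by at least `d + 1`. This is the `1`-extension: at the special
configuration with `v` in the middle of `x` and `y`, the rows of `v x` and `v y` add up to half the
row of `x y`. -/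
theorem rigidityRank_add_succ_le (G : SimpleGraph V) {p : V → Fin d → ℝ}
    (hp : AlgebraicIndependent ℚ fun x : V × Fin d => p x.1 x.2) {S N : Finset V} {v x y : V}
    (hv : v ∉ S) (hNS : N ⊆ S) (hadj : ∀ u ∈ N, G.Adj v u) (hN : N.card = d + 1)
    (hx : x ∈ N) (hy : y ∈ N) (hxy : row p x y ∉ rowSpan p (edgesIn G S)) :
    rigidityRank G p S + (d + 1) ≤ rigidityRank G p (insert v S) := by
  have hvN : ∀ u ∈ N, v ≠ u := fun u hu h => hv (hNS (h ▸ hu))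
  have hne : x ≠ y := by
    rintro rfl
    exact hxy (by rw [row_self]; exact zero_mem _)
  let q := Function.update p v ((1 / 2 : ℝ) • (p x + p y))
  have hqv : q v = (1 / 2 : ℝ) • (p x + p y) := Function.update_self ..
  have hq : ∀ u, v ≠ u → q u = p u := fun u hu => Function.update_of_ne hu.symm ..
  have hmem : ∀ u ∈ N, row q v u ∈ rowSpan q (edgesIn G (insert v S)) := fun u hu =>
    row_mem_rowSpan q ⟨by simp, by simp [hNS hu], hadj u hu⟩
  have hmid : row p x y = (2 : ℝ) • (row q v x + row q v y) := by
    ext w i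
    simp only [row, hqv, hq x (hvN x hx), hq y (hvN y hy), Pi.add_apply, Pi.single_apply,
      Pi.smul_apply, smul_eq_mul]
    split_ifs <;> simp_all <;> ring
  refine le_trans ?_ (finrank_rowSpan_le_of_generic hp q _)
  have hle : rowSpan p (edgesIn G S) ≤ rowSpan q (edgesIn G (insert v S)) := by
    rw [rowSpan_le]
    rintro a b ⟨ha, hb, hab⟩
    have : row p a b = row q a b := by
      simp only [row, hq a fun h => hv (h ▸ ha), hq b fun h => hv (h ▸ hb)]
    rw [this]
    exact row_mem_rowSpan q ⟨Finset.mem_insert_of_mem ha, Finset.mem_insert_of_mem hb, hab⟩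
  let U := rowSpan p (edgesIn G S) ⊔ Submodule.span ℝ {row p x y}
  have hU : rigidityRank G p S < Module.finrank ℝ U :=
    Submodule.finrank_lt_finrank_of_lt (left_lt_sup.2 fun h =>
      hxy (h (Submodule.mem_span_singleton_self _)))
  have hUle : U ≤ rowSpan q (edgesIn G (insert v S)) := by
    refine sup_le hle ?_
    rw [Submodule.span_singleton_le_iff_mem, hmid]
    exact Submodule.smul_mem _ _ (add_mem (hmem x hx) (hmem y hy))
  have hUker : U ≤ (LinearMap.proj v : (V → Fin d → ℝ) →ₗ[ℝ] Fin d → ℝ).ker := by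
    refine sup_le (rowSpan_edgesIn_le_ker_proj G p hv) ?_
    rw [Submodule.span_singleton_le_iff_mem]
    exact row_apply_of_ne p (hvN x hx) (hvN y hy)
  have hli := linearIndependent_sub_of_generic hp (Finset.notMem_erase x N)
    (by rw [Finset.card_erase_of_mem hx, hN, Nat.add_sub_cancel])
  have himage : d ≤ Module.finrank ℝ ((rowSpan q (edgesIn G (insert v S))).map
      (LinearMap.proj v : (V → Fin d → ℝ) →ₗ[ℝ] Fin d → ℝ)) := by
    have h := finrank_span_eq_card hli
    rw [Fintype.card_coe, Finset.card_erase_of_mem hx, hN, Nat.add_sub_cancel] at h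
    conv_lhs => rw [← h]
    refine Submodule.finrank_mono (Submodule.span_le.2 ?_)
    rintro _ ⟨u, rfl⟩
    have hu := Finset.mem_of_mem_erase u.2
    refine ⟨row q v x - row q v u, sub_mem (hmem x hx) (hmem u hu), ?_⟩
    simp [row_apply_left q (hvN x hx), row_apply_left q (hvN u hu), hq x (hvN x hx),
      hq u (hvN u hu)]
  have := finrank_add_finrank_map_le _ hUle hUker
  omega

/-- The rows vanish outside `S` and have column sums zero, so the columns of one vertex of `S` are
redundant. -/
theorem rigidityRank_lt (G : SimpleGraph V) (p : V → Fin d → ℝ) (hd : 1 ≤ d) {S : Finset V}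
    (hS : S.Nonempty) : rigidityRank G p S < d * S.card := by
  obtain ⟨s, hs⟩ := hS
  let f : (V → Fin d → ℝ) →ₗ[ℝ] (S.erase s → Fin d → ℝ) :=
    LinearMap.funLeft ℝ (Fin d → ℝ) Subtype.val
  have hzero : ∀ w ∈ rowSpan p (edgesIn G S), ∀ v ∉ S, w v = 0 := fun w hw v hv =>
    rowSpan_edgesIn_le_ker_proj G p hv hw
  have hsum : rowSpan p (edgesIn G S) ≤
      (∑ v, LinearMap.proj v : (V → Fin d → ℝ) →ₗ[ℝ] Fin d → ℝ).ker := by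
    rw [rowSpan_le]
    rintro x y -
    simp [row, Finset.sum_add_distrib]
  have hinj : Function.Injective (f.domRestrict (rowSpan p (edgesIn G S))) := by
    rw [← LinearMap.ker_eq_bot, LinearMap.ker_eq_bot']
    rintro ⟨w, hw⟩ h0
    have h1 : ∀ v, v ≠ s → w v = 0 := by
      intro v hv
      by_cases hvS : v ∈ S
      · exact congrFun h0 ⟨v, Finset.mem_erase.2 ⟨hv, hvS⟩⟩
      · exact hzero w hw v hvS
    have h2 : ∑ v, w v = 0 := by simpa using hsum hw
    rw [Finset.sum_eq_single s (fun v _ hv => h1 v hv) (by simp)] at h2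
    ext v : 2
    by_cases hv : v = s
    · subst hv; exact h2
    · exact h1 v hv
  have h := LinearMap.finrank_le_finrank_of_injective hinj
  have hc : 0 < S.card := Finset.card_pos.2 ⟨s, hs⟩
  have h4 : Module.finrank ℝ (S.erase s → Fin d → ℝ) = (S.card - 1) * d := by
    rw [Module.finrank_pi_fintype]
    simp [Finset.card_erase_of_mem hs]
  rw [h4] at h
  calc rigidityRank G p S ≤ (S.card - 1) * d := h
    _ < S.card * d := Nat.mul_lt_mul_of_pos_right (by omega) (by omega)
    _ = d * S.card := mul_comm ..

end

section

variable {V : Type*} [DecidableEq V] {d : ℕ}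

/-! ### Cliques with `d` common vertices -/

/-- Any `d + 2` generic points of `ℝ^d` are affinely dependent, and every coefficient of the
dependency is nonzero. -/
theorem exists_affine_dependency {p : V → Fin d → ℝ}
    (hp : AlgebraicIndependent ℚ fun x : V × Fin d => p x.1 x.2) {C : Finset V} {x y : V}
    (hC : C.card = d) (hx : x ∉ C) (hy : y ∉ C) (hxy : x ≠ y) :
    ∃ c : V → ℝ, ∑ u ∈ insert x (insert y C), c u = 0 ∧
      ∑ u ∈ insert x (insert y C), c u • p u = 0 ∧ c x ≠ 0 ∧ c y ≠ 0 := by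
  have hx' : x ∉ insert y C := by simp [hxy, hx]
  have hli : ∀ v, v ∉ C → ∀ g : V → ℝ, ∑ u ∈ C, g u • (p u - p v) = 0 → ∀ u ∈ C, g u = 0 :=
    fun v hv => linearIndepOn_finset_iff.1 (linearIndependent_sub_of_generic hp hv hC.le)
  have hdep : ¬ LinearIndepOn ℝ (fun u => p u - p x) (insert y C : Finset V) := by
    intro h
    have := LinearIndependent.fintype_card_le_finrank h
    simp [hC, hy] at this
  rw [linearIndepOn_finset_iff] at hdep
  push Not at hdep
  obtain ⟨g, hg, u₀, hu₀, hgu₀⟩ := hdep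
  have hnz : ¬ (g y = 0 ∧ ∀ u ∈ C, g u = 0) := fun h => by
    rcases Finset.mem_insert.1 hu₀ with rfl | h'
    · exact hgu₀ h.1
    · exact hgu₀ (h.2 _ h')
  have hgy : g y ≠ 0 := by
    intro h0
    rw [Finset.sum_insert hy, h0, zero_smul, zero_add] at hg
    exact hnz ⟨h0, hli x hx g hg⟩
  have hgx : ∑ u ∈ insert y C, g u ≠ 0 := by
    intro h0
    -- With coefficient zero at `x`, the relation can be rewritten with base point `y`.
    have h1 : ∑ u ∈ insert y C, g u • (p u - p y) = 0 := by
      simp only [smul_sub, Finset.sum_sub_distrib, ← Finset.sum_smul, h0, zero_smul] at hg ⊢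
      exact hg
    rw [Finset.sum_insert hy, sub_self, smul_zero, zero_add] at h1
    have h2 := hli y hy g h1
    rw [Finset.sum_insert hy, Finset.sum_eq_zero h2, add_zero] at h0
    exact hgy h0
  have hupd : ∀ b, ∀ u ∈ insert y C, Function.update g x b u = g u := fun b u hu =>
    Function.update_of_ne (by rintro rfl; exact hx' hu) ..
  refine ⟨Function.update g x (-∑ u ∈ insert y C, g u), ?_, ?_, ?_, ?_⟩
  · rw [Finset.sum_insert hx', Function.update_self, Finset.sum_congr rfl (hupd _),
      neg_add_cancel]
  · have h1 : ∀ b, ∑ u ∈ insert y C, Function.update g x b u • p u =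
        ∑ u ∈ insert y C, g u • p u := fun b =>
      Finset.sum_congr rfl fun u hu => by rw [hupd b u hu]
    rw [Finset.sum_insert hx', Function.update_self, h1]
    simp only [smul_sub, Finset.sum_sub_distrib, ← Finset.sum_smul] at hg
    rw [neg_smul, neg_add_eq_sub, hg]
  · simpa using hgx
  · rwa [Function.update_of_ne hxy.symm]

/-- The coefficients `c` of an affine dependency give the self-stress `c a * c b`. -/
theorem sum_smul_row_eq_zero (p : V → Fin d → ℝ) {T : Finset V} {c : V → ℝ}
    (h1 : ∑ u ∈ T, c u = 0) (h2 : ∑ u ∈ T, c u • p u = 0) :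
    ∑ a ∈ T, ∑ b ∈ T, (c a * c b) • row p a b = 0 := by
  have key : ∀ a, ∑ b ∈ T, c b • (p a - p b) = 0 := fun a => by
    simp only [smul_sub, Finset.sum_sub_distrib, ← Finset.sum_smul, h1, h2, zero_smul, sub_zero]
  have hleft : ∑ a ∈ T, ∑ b ∈ T,
      (c a * c b) • (Pi.single a (p a - p b) : V → Fin d → ℝ) = 0 := by
    refine Finset.sum_eq_zero fun a _ => ?_
    ext v : 1
    simp only [Finset.sum_apply, Pi.smul_apply, Pi.single_apply, Pi.zero_apply]
    by_cases hv : v = a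
    · simp only [hv, if_true, mul_smul, ← Finset.smul_sum, key, smul_zero]
    · simp [hv]
  simp only [row, smul_add, Finset.sum_add_distrib, hleft, zero_add]
  rw [Finset.sum_comm, ← hleft]
  simp only [mul_comm]

/-- If `x` and `y` are both adjacent to all vertices of a clique on `d` vertices, then the row of
`x y` lies in the span of the rows of the edges. -/
theorem row_mem_rowSpan_of_common_clique (G : SimpleGraph V) {p : V → Fin d → ℝ}
    (hp : AlgebraicIndependent ℚ fun x : V × Fin d => p x.1 x.2) {C : Finset V} {x y : V}
    (hC : C.card = d) (hclique : G.IsClique (C : Set V)) (hx : ∀ u ∈ C, G.Adj x u)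
    (hy : ∀ u ∈ C, G.Adj y u) (hxy : x ≠ y) :
    row p x y ∈ rowSpan p {e | G.Adj e.1 e.2} := by
  have hxC : x ∉ C := fun h => G.loopless.irrefl x (hx x h)
  have hyC : y ∉ C := fun h => G.loopless.irrefl y (hy y h)
  obtain ⟨c, h1, h2, hcx, hcy⟩ := exists_affine_dependency hp hC hxC hyC hxy
  have h := sum_smul_row_eq_zero p h1 h2
  rw [← Finset.sum_product'] at h
  let W := rowSpan p {e : V × V | G.Adj e.1 e.2}
  have h' := congrArg W.mkQ h
  rw [map_sum, map_zero] at h'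
  have hzero : ∀ e ∈ insert x (insert y C) ×ˢ insert x (insert y C),
      e ≠ (x, y) ∧ e ≠ (y, x) → W.mkQ ((c e.1 * c e.2) • row p e.1 e.2) = 0 := by
    rintro ⟨a, b⟩ hab ⟨hne1, hne2⟩
    rw [Submodule.mkQ_apply, Submodule.Quotient.mk_eq_zero]
    refine Submodule.smul_mem _ _ ?_
    by_cases heq : a = b
    · rw [heq, row_self]; exact zero_mem _
    refine row_mem_rowSpan p ?_
    change G.Adj a b
    simp only [Finset.mem_product, Finset.mem_insert] at hab
    obtain ⟨rfl | rfl | ha, rfl | rfl | hb⟩ := hab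
    · exact absurd rfl heq
    · exact absurd rfl hne1
    · exact hx b hb
    · exact absurd rfl hne2
    · exact absurd rfl heq
    · exact hy b hb
    · exact (hx a ha).symm
    · exact (hy a ha).symm
    · exact hclique ha hb heq
  rw [Finset.sum_eq_add (x, y) (y, x) (by simp [hxy]) hzero (by simp) (by simp), ← map_add,
    row_comm p y x, mul_comm (c y), ← add_smul, Submodule.mkQ_apply,
    Submodule.Quotient.mk_eq_zero] at h'
  refine (Submodule.smul_mem_iff _ ?_).1 h'
  have := mul_ne_zero hcx hcy
  rw [← two_mul]
  positivity

end

/-! ### The gain of a vertex -/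

section

variable {V : Type*} {d : ℕ}

open Classical in
/-- The neighbours of `v` in `S`. -/
noncomputable def neighborsIn (G : SimpleGraph V) (S : Finset V) (v : V) : Finset V :=
  S.filter (G.Adj v)

theorem mem_neighborsIn {G : SimpleGraph V} {S : Finset V} {u v : V} :
    u ∈ neighborsIn G S v ↔ u ∈ S ∧ G.Adj v u := by
  simp [neighborsIn]

/-- `M` has more than `d` vertices and is not a clique. -/
def IsLooseSet (G : SimpleGraph V) (d : ℕ) (M : Finset V) : Prop :=
  d + 1 ≤ M.card ∧ ¬ G.IsClique (M : Set V)

open Classical in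
/-- A lower bound for the increase of the rank when a vertex with neighbourhood `M` is added. -/
noncomputable def gain (G : SimpleGraph V) (d : ℕ) (M : Finset V) : ℕ :=
  min d M.card + if IsLooseSet G d M then 1 else 0

theorem rigidityRank_add_gain_le [DecidableEq V] [Fintype V] {G : SimpleGraph V}
    {p : V → Fin d → ℝ} (hp : AlgebraicIndependent ℚ fun x : V × Fin d => p x.1 x.2) (hd : 1 ≤ d)
    (hclosed : ∀ x y, x ≠ y → row p x y ∈ rowSpan p {e | G.Adj e.1 e.2} → G.Adj x y)
    {S : Finset V} {v : V} (hv : v ∉ S) :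
    rigidityRank G p S + gain G d (neighborsIn G S v) ≤ rigidityRank G p (insert v S) := by
  have hsub : ∀ N ⊆ neighborsIn G S v, N ⊆ S ∧ ∀ u ∈ N, G.Adj v u := fun N hN =>
    ⟨fun u hu => (mem_neighborsIn.1 (hN hu)).1, fun u hu => (mem_neighborsIn.1 (hN hu)).2⟩
  unfold gain
  split_ifs with h
  · obtain ⟨hcard, hnc⟩ := h
    rw [SimpleGraph.isClique_iff, Set.Pairwise] at hnc
    push Not at hnc
    obtain ⟨x, hx, y, hy, hne, hxy⟩ := hnc
    obtain ⟨N, hxyN, hN, hNcard⟩ := Finset.exists_subsuperset_card_eq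
      (s := {x, y}) (t := neighborsIn G S v) (n := d + 1)
      (by simpa [Finset.insert_subset_iff] using ⟨hx, hy⟩)
      (by rw [Finset.card_pair hne]; omega) hcard
    rw [min_eq_left (by omega)]
    refine rigidityRank_add_succ_le G hp hv (hsub N hN).1 (hsub N hN).2 hNcard
      (x := x) (y := y) (hxyN (by simp))
      (hxyN (by simp)) fun hmem => hxy (hclosed x y hne ?_)
    exact rowSpan_mono p (fun e he => he.2.2) hmem
  · obtain ⟨N, hN, hNcard⟩ := Finset.exists_subset_card_eq
      (min_le_right d (neighborsIn G S v).card)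
    have := rigidityRank_add_card_le G hp hv (hsub N hN).1 (hsub N hN).2
      (by rw [hNcard]; exact min_le_left _ _)
    rwa [hNcard] at this

/-! ### Averaging over the vertex orderings -/

open Classical in
/-- A lower bound for the mean of `gain` over the part of the neighbourhood `M` of a vertex that
precedes it in a random ordering. -/
noncomputable def meanGain (G : SimpleGraph V) (d : ℕ) (M : Finset V) : ℝ :=
  if IsLooseSet G d M then d + 1 / 2 - d * (d + 1) / (2 * M.card)
  else if M.card ≤ d then M.card / 2 else d - d * (d + 1) / (2 * (M.card + 1))

theorem meanGain_of_not_isLooseSet {G : SimpleGraph V} {M : Finset V}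
    (h : ¬ IsLooseSet G d M) (hM : d ≤ M.card) :
    meanGain G d M = d - d * (d + 1) / (2 * (M.card + 1)) := by
  rw [meanGain, if_neg h]
  split_ifs with hle
  · rw [le_antisymm hle hM]
    field_simp
    ring
  · rfl

/-- The lower bound `meanGain` satisfies the recursion of the mean, obtained by conditioning on the
last vertex in the ordering of `M` and its centre, as an inequality. -/
theorem card_add_one_mul_meanGain_le [DecidableEq V] {G : SimpleGraph V} {M : Finset V}
    (hM : ∀ v ∈ M, ∀ w ∈ M, v ≠ w → d + 1 ≤ M.card → G.IsClique (M.erase v : Set V) →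
      G.IsClique (M.erase w : Set V) → G.IsClique (M : Set V)) :
    (M.card + 1) * meanGain G d M ≤ gain G d M + ∑ v ∈ M, meanGain G d (M.erase v) := by
  have hcard : ∀ v ∈ M, (M.erase v).card = M.card - 1 := fun v hv => Finset.card_erase_of_mem hv
  by_cases hloose : IsLooseSet G d M
  · obtain ⟨hD, hnc⟩ := hloose
    have hgain : (gain G d M : ℝ) = d + 1 := by
      rw [gain, if_pos ⟨hD, hnc⟩, min_eq_left (by omega)]; push_cast; ring
    rw [hgain, meanGain, if_pos ⟨hD, hnc⟩]
    obtain ⟨D, hDM⟩ : ∃ D, M.card = D + 1 := ⟨M.card - 1, by omega⟩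
    have hcard' : ∀ v ∈ M, (M.erase v).card = D := fun v hv => by rw [hcard v hv, hDM]; rfl
    rcases Nat.lt_or_ge D (d + 1) with hlt | hge
    · have hDd : D = d := by omega
      subst hDd
      have : ∀ v ∈ M, meanGain G D (M.erase v) = D / 2 := fun v hv => by
        rw [meanGain, if_neg (by rintro ⟨h, -⟩; rw [hcard' v hv] at h; omega),
          if_pos (hcard' v hv).le, hcard' v hv]
      rw [Finset.sum_congr rfl this, Finset.sum_const, hDM, nsmul_eq_mul]
      push_cast
      field_simp
      ring_nf
      rfl
    · have hDpos : (0 : ℝ) < D := by exact_mod_cast (by omega : 0 < D)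
      have hDd : (d : ℝ) + 1 ≤ D := by exact_mod_cast hge
      have hlow : ∀ v ∈ M, (G.IsClique (M.erase v : Set V) ∧
          meanGain G d (M.erase v) = d - d * (d + 1) / (2 * (D + 1))) ∨
          (¬ G.IsClique (M.erase v : Set V) ∧
          meanGain G d (M.erase v) = d + 1 / 2 - d * (d + 1) / (2 * D)) := by
        intro v hv
        by_cases hcl : G.IsClique (M.erase v : Set V)
        · exact .inl ⟨hcl, by
            rw [meanGain_of_not_isLooseSet (fun h => h.2 hcl) (by rw [hcard' v hv]; omega),
              hcard' v hv]⟩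
        · exact .inr ⟨hcl, by
            rw [meanGain, if_pos ⟨by rw [hcard' v hv]; exact hge, hcl⟩, hcard' v hv]⟩
      have hcmp : (d : ℝ) - d * (d + 1) / (2 * (D + 1)) ≤
          d + 1 / 2 - d * (d + 1) / (2 * D) := by
        have : (d : ℝ) + 1 / 2 - d * (d + 1) / (2 * D) - (d - d * (d + 1) / (2 * (D + 1))) =
            (D * (D + 1) - d * (d + 1)) / (2 * D * (D + 1)) := by
          field_simp
          ring
        have h2 : (0 : ℝ) ≤ (D * (D + 1) - d * (d + 1)) / (2 * D * (D + 1)) := by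
          apply div_nonneg _ (by positivity)
          have : (0 : ℝ) ≤ d := d.cast_nonneg
          nlinarith
        linarith
      -- At most one of the sets `M.erase v` is a clique.
      obtain ⟨v₀, hv₀, hrest⟩ : ∃ v₀ ∈ M, ∀ v ∈ M.erase v₀,
          meanGain G d (M.erase v) = d + 1 / 2 - d * (d + 1) / (2 * D) := by
        by_cases hex : ∃ v ∈ M, G.IsClique (M.erase v : Set V)
        · obtain ⟨v₀, hv₀, hcl⟩ := hex
          refine ⟨v₀, hv₀, fun v hv => ?_⟩
          obtain ⟨hne, hvM⟩ := Finset.mem_erase.1 hv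
          rcases hlow v hvM with h | h
          · exact absurd (hM v hvM v₀ hv₀ hne hD h.1 hcl) hnc
          · exact h.2
        · push Not at hex
          obtain ⟨v₀, hv₀⟩ : M.Nonempty := Finset.card_pos.1 (by omega)
          refine ⟨v₀, hv₀, fun v hv => ?_⟩
          have hvM := Finset.mem_of_mem_erase hv
          exact ((hlow v hvM).resolve_left fun h => hex v hvM h.1).2
      have hone : (d : ℝ) - d * (d + 1) / (2 * (D + 1)) ≤ meanGain G d (M.erase v₀) := by
        rcases hlow v₀ hv₀ with h | h
        · exact h.2.ge
        · exact hcmp.trans h.2.ge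
      rw [← Finset.add_sum_erase M _ hv₀, Finset.sum_congr rfl hrest, Finset.sum_const,
        hcard' v₀ hv₀, hDM, nsmul_eq_mul]
      have hid : ((D + 1 : ℕ) + 1 : ℝ) * (d + 1 / 2 - d * (d + 1) / (2 * (D + 1 : ℕ))) =
          d + 1 + (d - d * (d + 1) / (2 * (D + 1)) +
            D * (d + 1 / 2 - d * (d + 1) / (2 * D))) := by
        push_cast
        field_simp
        ring
      rw [hid]
      linarith
  · have hsub : ∀ v ∈ M, ¬ IsLooseSet G d (M.erase v) := by
      rintro v hv ⟨h1, h2⟩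
      rw [hcard v hv] at h1
      refine hloose ⟨by omega, fun h => h2 (h.subset ?_)⟩
      exact_mod_cast Finset.erase_subset v M
    rw [gain, if_neg hloose, add_zero]
    rcases Nat.lt_or_ge d M.card with hlt | hle
    · obtain ⟨D, hDM⟩ : ∃ D, M.card = D + 1 := ⟨M.card - 1, by omega⟩
      have : ∀ v ∈ M, meanGain G d (M.erase v) = d - d * (d + 1) / (2 * (D + 1)) := by
        intro v hv
        have hc : (M.erase v).card = D := by rw [hcard v hv, hDM]; rfl
        rw [meanGain_of_not_isLooseSet (hsub v hv) (by omega), hc]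
      rw [Finset.sum_congr rfl this, meanGain_of_not_isLooseSet hloose hlt.le, Finset.sum_const,
        min_eq_left hlt.le, hDM, nsmul_eq_mul]
      apply le_of_eq
      push_cast
      field_simp
      ring
    · have : ∀ v ∈ M, meanGain G d (M.erase v) = (M.card - 1) / 2 := by
        intro v hv
        have hpos : 1 ≤ M.card := Finset.card_pos.2 ⟨v, hv⟩
        rw [meanGain, if_neg (hsub v hv), if_pos (by rw [hcard v hv]; omega), hcard v hv,
          Nat.cast_sub hpos, Nat.cast_one]
      rw [Finset.sum_congr rfl this, meanGain, if_neg hloose, if_pos hle, Finset.sum_const,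
        min_eq_right hle, nsmul_eq_mul]
      apply le_of_eq
      ring

end

section

variable {V : Type*} [DecidableEq V] {d : ℕ}

theorem neighborsIn_erase {G : SimpleGraph V} {U : Finset V} {u v : V} :
    neighborsIn G (U.erase v) u = (neighborsIn G U u).erase v := by
  ext w
  simp [mem_neighborsIn, and_assoc]

theorem neighborsIn_subset_erase {G : SimpleGraph V} {U : Finset V} {u : V} :
    neighborsIn G U u ⊆ U.erase u := fun w hw => by
  have h := mem_neighborsIn.1 hw
  exact Finset.mem_erase.2 ⟨h.2.ne', h.1⟩

/-- If adding a vertex raises `r` by at least its gain, then `r U` is at least the sum of the mean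
gains. The induction averages over the last vertex of `U` in the ordering. -/
theorem sum_meanGain_le {G : SimpleGraph V} {r : Finset V → ℝ} (h0 : 0 ≤ r ∅)
    (hr : ∀ S v, v ∉ S → r S + gain G d (neighborsIn G S v) ≤ r (insert v S))
    (hrec : ∀ u (M : Finset V), (∀ w ∈ M, G.Adj u w) →
      (M.card + 1) * meanGain G d M ≤ gain G d M + ∑ v ∈ M, meanGain G d (M.erase v))
    (U : Finset V) : ∑ u ∈ U, meanGain G d (neighborsIn G U u) ≤ r U := by
  induction U using Finset.strongInduction with
  | H U ih =>
    rcases U.eq_empty_or_nonempty with rfl | hU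
    · simpa using h0
    have hpos : (0 : ℝ) < U.card := by exact_mod_cast Finset.card_pos.2 hU
    refine le_of_mul_le_mul_left ?_ hpos
    have hstep : ∀ v ∈ U, (∑ u ∈ U.erase v, meanGain G d ((neighborsIn G U u).erase v)) +
        gain G d (neighborsIn G U v) ≤ r U := by
      intro v hv
      have h1 := ih _ (Finset.erase_ssubset hv)
      have h2 := hr (U.erase v) v (Finset.notMem_erase v U)
      rw [Finset.insert_erase hv, neighborsIn_erase, Finset.erase_eq_of_notMem
        (fun h => G.loopless.irrefl v (mem_neighborsIn.1 h).2)] at h2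
      simp only [neighborsIn_erase] at h1
      linarith
    have hswap : ∑ v ∈ U, ∑ u ∈ U.erase v, meanGain G d ((neighborsIn G U u).erase v) =
        ∑ u ∈ U, ∑ v ∈ U.erase u, meanGain G d ((neighborsIn G U u).erase v) :=
      Finset.sum_comm' fun v u => by simp only [Finset.mem_erase]; tauto
    have hvertex : ∀ u ∈ U, U.card * meanGain G d (neighborsIn G U u) ≤
        (∑ v ∈ U.erase u, meanGain G d ((neighborsIn G U u).erase v)) +
          gain G d (neighborsIn G U u) := by
      intro u hu
      have hsub := neighborsIn_subset_erase (G := G) (U := U) (u := u)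
      have h1 := hrec u (neighborsIn G U u) fun w hw => (mem_neighborsIn.1 hw).2
      have h2 : ∀ v ∈ U.erase u \ neighborsIn G U u,
          meanGain G d ((neighborsIn G U u).erase v) = meanGain G d (neighborsIn G U u) :=
        fun v hv => by rw [Finset.erase_eq_of_notMem (Finset.mem_sdiff.1 hv).2]
      have h3 : ((U.erase u \ neighborsIn G U u).card : ℝ) =
          U.card - 1 - (neighborsIn G U u).card := by
        rw [Finset.card_sdiff_of_subset hsub, Nat.cast_sub (Finset.card_le_card hsub),
          Finset.card_erase_of_mem hu, Nat.cast_sub (Finset.card_pos.2 hU), Nat.cast_one]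
      rw [← Finset.sum_sdiff hsub, Finset.sum_congr rfl h2, Finset.sum_const, nsmul_eq_mul, h3]
      linarith
    calc (U.card : ℝ) * ∑ u ∈ U, meanGain G d (neighborsIn G U u)
        = ∑ u ∈ U, U.card * meanGain G d (neighborsIn G U u) := Finset.mul_sum ..
      _ ≤ ∑ u ∈ U, ((∑ v ∈ U.erase u, meanGain G d ((neighborsIn G U u).erase v)) +
          gain G d (neighborsIn G U u)) := Finset.sum_le_sum hvertex
      _ = ∑ v ∈ U, ((∑ u ∈ U.erase v, meanGain G d ((neighborsIn G U u).erase v)) +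
          gain G d (neighborsIn G U v)) := by
        rw [Finset.sum_add_distrib, Finset.sum_add_distrib, hswap]
      _ ≤ ∑ v ∈ U, r U := Finset.sum_le_sum hstep
      _ = U.card * r U := by rw [Finset.sum_const, nsmul_eq_mul]

/-! ### Highly connected graphs that are closed in the rigidity matroid -/

/-- Vertices with `d` common neighbours that form a clique are adjacent. -/
def HasCliqueMerging (G : SimpleGraph V) (d : ℕ) : Prop :=
  ∀ (C : Finset V) (x y : V), C.card = d → G.IsClique (C : Set V) → (∀ u ∈ C, G.Adj x u) →
    (∀ u ∈ C, G.Adj y u) → x ≠ y → G.Adj x y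

/-- In a neighbourhood, two cliques that differ in one vertex and have at least `d - 1` common
vertices merge: together with the centre they have `d` common vertices. -/
theorem HasCliqueMerging.isClique_of_erase {G : SimpleGraph V} (hG : HasCliqueMerging G d)
    (hd : 1 ≤ d) {u : V} {M : Finset V} (hM : ∀ w ∈ M, G.Adj u w) {v w : V} (hv : v ∈ M)
    (hw : w ∈ M) (hvw : v ≠ w) (hcard : d + 1 ≤ M.card) (h1 : G.IsClique (M.erase v : Set V))
    (h2 : G.IsClique (M.erase w : Set V)) : G.IsClique (M : Set V) := by
  have hadj : G.Adj v w := by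
    have hc : ((M.erase v).erase w).card = M.card - 2 := by
      rw [Finset.card_erase_of_mem (Finset.mem_erase.2 ⟨hvw.symm, hw⟩),
        Finset.card_erase_of_mem hv]
      omega
    obtain ⟨C, hC, hCcard⟩ := Finset.exists_subset_card_eq
      (s := (M.erase v).erase w) (n := d - 1) (by omega)
    have hCM : ∀ a ∈ C, a ≠ w ∧ a ≠ v ∧ a ∈ M := fun a ha => by simpa using hC ha
    have huC : u ∉ C := fun h => G.loopless.irrefl u (hM u (hCM u h).2.2)
    refine hG (insert u C) v w (by rw [Finset.card_insert_of_notMem huC]; omega) ?_ ?_ ?_ hvw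
    · rw [Finset.coe_insert, SimpleGraph.isClique_insert]
      refine ⟨h1.subset fun a ha => ?_, fun a ha _ => hM a (hCM a ha).2.2⟩
      simp [(hCM a ha).2]
    · intro a ha
      rcases Finset.mem_insert.1 ha with rfl | ha
      · exact (hM v hv).symm
      · exact h2 (by simp [hv, hvw]) (by simp [hCM a ha]) (hCM a ha).2.1.symm
    · intro a ha
      rcases Finset.mem_insert.1 ha with rfl | ha
      · exact (hM w hw).symm
      · exact h1 (by simp [hw, hvw.symm]) (by simp [hCM a ha]) (hCM a ha).1.symm
  intro a ha b hb hab
  by_cases hv' : a ≠ v ∧ b ≠ v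
  · exact h1 (by simpa using ⟨ha, hv'.1⟩) (by simpa using ⟨hb, hv'.2⟩) hab
  by_cases hw' : a ≠ w ∧ b ≠ w
  · exact h2 (by simpa using ⟨ha, hw'.1⟩) (by simpa using ⟨hb, hw'.2⟩) hab
  have : (a = v ∧ b = w) ∨ (a = w ∧ b = v) := by grind
  rcases this with ⟨rfl, rfl⟩ | ⟨rfl, rfl⟩
  · exact hadj
  · exact hadj.symm

/-- The subgraph of `G` induced by `U` has at least `k + 1` vertices, and any two nonempty vertex
sets `A`, `B` without edges between them leave at least `k` vertices of `U` uncovered. -/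
def HasNoSmallCut (G : SimpleGraph V) (k : ℕ) (U : Finset V) : Prop :=
  k + 1 ≤ U.card ∧ ∀ A ⊆ U, ∀ B ⊆ U, Disjoint A B → A.Nonempty → B.Nonempty →
    (∀ a ∈ A, ∀ b ∈ B, ¬ G.Adj a b) → k ≤ (U \ (A ∪ B)).card

theorem IsKConnected.hasNoSmallCut [Fintype V] {G : SimpleGraph V} {k : ℕ}
    (hG : IsKConnected G k) : HasNoSmallCut G k Finset.univ := by
  refine ⟨by simpa using hG.1, fun A _ B _ hdis hA hB hAB => ?_⟩
  by_contra! hlt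
  obtain ⟨a, ha⟩ := hA
  obtain ⟨b, hb⟩ := hB
  have hconn := hG.2 _ hlt
  have hmem : ∀ v, v ∈ ((Finset.univ \ (A ∪ B) : Finset V) : Set V)ᶜ ↔ v ∈ A ∨ v ∈ B := by
    simp [or_iff_not_imp_left]
  have hreach := hconn.preconnected ⟨a, (hmem a).2 (.inl ha)⟩ ⟨b, (hmem b).2 (.inr hb)⟩
  rw [SimpleGraph.reachable_iff_reflTransGen] at hreach
  have hbA : b ∈ A := by
    refine Relation.ReflTransGen.head_induction_on
      (motive := fun c _ => c.1 ∈ A → b ∈ A) hreach id ?_ ha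
    intro c e hce _ ih hc
    refine ih (((hmem e.1).1 e.2).resolve_right fun he => hAB _ hc _ he hce)
  exact Finset.disjoint_left.1 hdis hbA hb

theorem HasNoSmallCut.le_card_neighborsIn {G : SimpleGraph V} {k : ℕ} {U : Finset V}
    (hU : HasNoSmallCut G k U) {v : V} (hv : v ∈ U) : k ≤ (neighborsIn G U v).card := by
  have hsub := neighborsIn_subset_erase (G := G) (U := U) (u := v)
  rcases (U.erase v \ neighborsIn G U v).eq_empty_or_nonempty with h | h
  · have h1 := Finset.card_le_card (Finset.sdiff_eq_empty_iff_subset.1 h)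
    rw [Finset.card_erase_of_mem hv] at h1
    have := hU.1
    omega
  · refine (hU.2 {v} (by simpa using hv) _ (Finset.sdiff_subset.trans (Finset.erase_subset v U))
      (by simp) (by simp) h ?_).trans (Finset.card_le_card ?_)
    · intro a ha b hb hab
      rw [Finset.mem_singleton.1 ha] at hab
      rw [Finset.mem_sdiff, Finset.mem_erase] at hb
      exact hb.2 (mem_neighborsIn.2 ⟨hb.1.2, hab⟩)
    · intro w hw
      simp only [Finset.mem_sdiff, Finset.mem_union, Finset.mem_singleton, Finset.mem_erase] at hw
      tauto

/-- Deleting a simplicial vertex creates no small cut. -/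
theorem HasNoSmallCut.erase {G : SimpleGraph V} {k : ℕ} {U : Finset V}
    (hU : HasNoSmallCut G k U) (hnc : ¬ G.IsClique (U : Set V)) {v : V} (hv : v ∈ U)
    (hsimp : G.IsClique (neighborsIn G U v : Set V)) : HasNoSmallCut G k (U.erase v) := by
  constructor
  · rw [SimpleGraph.isClique_iff, Set.Pairwise] at hnc
    push Not at hnc
    obtain ⟨x, hx, y, hy, hne, hxy⟩ := hnc
    have hsub : ({x} ∪ {y} : Finset V) ⊆ U := by
      intro w hw
      simp only [Finset.mem_union, Finset.mem_singleton] at hw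
      rcases hw with rfl | rfl
      exacts [hx, hy]
    have h := hU.2 {x} (by simpa using hx) {y} (by simpa using hy) (by simpa using hne) (by simp)
      (by simp) (by simpa using hxy)
    have h2 : ({x} ∪ {y} : Finset V).card = 2 := Finset.card_pair hne
    have h3 := Finset.card_le_card hsub
    rw [Finset.card_sdiff_of_subset hsub, h2] at h
    rw [Finset.card_erase_of_mem hv]
    omega
  · -- `v` has no neighbour in one of `A` and `B`, and can be added to the other one.
    have key : ∀ A ⊆ U.erase v, ∀ B ⊆ U.erase v, Disjoint A B → A.Nonempty →
        (∀ a ∈ A, ∀ b ∈ B, ¬ G.Adj a b) → (∀ a ∈ A, ¬ G.Adj v a) →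
        k ≤ (U.erase v \ (A ∪ B)).card := by
      intro A hA B hB hdis hAne hAB hvA
      have hvA' : v ∉ A := fun h => Finset.notMem_erase v U (hA h)
      have h := hU.2 A (hA.trans (Finset.erase_subset v U)) (insert v B)
        (Finset.insert_subset hv (hB.trans (Finset.erase_subset v U)))
        (Finset.disjoint_insert_right.2 ⟨hvA', hdis⟩) hAne (Finset.insert_nonempty v B) (by
          intro a ha b hb hab
          rcases Finset.mem_insert.1 hb with rfl | hb
          · exact hvA a ha hab.symm
          · exact hAB a ha b hb hab)
      convert h using 2
      ext w
      simp only [Finset.mem_sdiff, Finset.mem_erase, Finset.mem_union, Finset.mem_insert]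
      tauto
    intro A hA B hB hdis hAne hBne hAB
    by_cases hvA : ∀ a ∈ A, ¬ G.Adj v a
    · exact key A hA B hB hdis hAne hAB hvA
    by_cases hvB : ∀ b ∈ B, ¬ G.Adj v b
    · rw [Finset.union_comm]
      exact key B hB A hA hdis.symm hBne (fun b hb a ha h => hAB a ha b hb h.symm) hvB
    push Not at hvA hvB
    obtain ⟨a, ha, hva⟩ := hvA
    obtain ⟨b, hb, hvb⟩ := hvB
    refine absurd (hsimp ?_ ?_ ?_) (hAB a ha b hb)
    · exact mem_neighborsIn.2 ⟨Finset.mem_of_mem_erase (hA ha), hva⟩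
    · exact mem_neighborsIn.2 ⟨Finset.mem_of_mem_erase (hB hb), hvb⟩
    · rintro rfl
      exact Finset.disjoint_left.1 hdis ha hb

theorem isClique_of_erase_of_hasCliqueMerging {G : SimpleGraph V} (hG : HasCliqueMerging G d)
    {U : Finset V} {v : V} (hcl : G.IsClique (U.erase v : Set V))
    (hcard : d ≤ (neighborsIn G U v).card) : G.IsClique (U : Set V) := by
  obtain ⟨C, hC, hCcard⟩ := Finset.exists_subset_card_eq hcard
  have hvC : ∀ u ∈ C, G.Adj v u := fun u hu => (mem_neighborsIn.1 (hC hu)).2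
  have hCU : C ⊆ U.erase v := hC.trans neighborsIn_subset_erase
  have hadj : ∀ y ∈ U, v ≠ y → G.Adj v y := by
    intro y hy hne
    by_cases hyC : y ∈ C
    · exact hvC y hyC
    · refine hG C v y hCcard (hcl.subset (by exact_mod_cast hCU)) hvC (fun u hu => ?_) hne
      exact hcl (by simpa using ⟨hy, hne.symm⟩) (hCU hu) fun h => hyC (h ▸ hu)
  intro a ha b hb hab
  by_cases hav : a = v
  · subst hav; exact hadj b hb hab
  by_cases hbv : b = v
  · subst hbv; exact (hadj a ha hab.symm).symm
  exact hcl (by simpa using ⟨ha, hav⟩) (by simpa using ⟨hb, hbv⟩) hab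

theorem HasCliqueMerging.isClique {G : SimpleGraph V} (hG : HasCliqueMerging G d) (hd : 1 ≤ d)
    {r : Finset V → ℝ} (h0 : 0 ≤ r ∅)
    (hr : ∀ S v, v ∉ S → r S + gain G d (neighborsIn G S v) ≤ r (insert v S))
    (hlt : ∀ U : Finset V, U.Nonempty → r U < d * U.card)
    {U : Finset V} (hU : HasNoSmallCut G (d * (d + 1)) U) : G.IsClique (U : Set V) := by
  induction U using Finset.strongInduction with
  | H U ih =>
    by_contra hnc
    have hdk : d + 1 ≤ d * (d + 1) := Nat.le_mul_of_pos_left _ hd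
    by_cases hex : ∃ v ∈ U, G.IsClique (neighborsIn G U v : Set V)
    · obtain ⟨v, hv, hsimp⟩ := hex
      have hdeg := hU.le_card_neighborsIn hv
      exact hnc (isClique_of_erase_of_hasCliqueMerging hG
        (ih _ (Finset.erase_ssubset hv) (hU.erase hnc hv hsimp)) (by omega))
    · push Not at hex
      have hUne : U.Nonempty := Finset.card_pos.1 (by have := hU.1; omega)
      have hsum := sum_meanGain_le h0 hr (fun u M hM => card_add_one_mul_meanGain_le
        fun v hv w hw hvw hc h1 h2 => hG.isClique_of_erase hd hM hv hw hvw hc h1 h2) U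
      have hge : ∀ u ∈ U, (d : ℝ) ≤ meanGain G d (neighborsIn G U u) := by
        intro u hu
        have hdeg := hU.le_card_neighborsIn hu
        rw [meanGain, if_pos ⟨by omega, hex u hu⟩]
        have hdeg' : (d : ℝ) * (d + 1) ≤ (neighborsIn G U u).card := by exact_mod_cast hdeg
        have hpos : (0 : ℝ) < (neighborsIn G U u).card := by exact_mod_cast (by omega)
        have : (d : ℝ) * (d + 1) / (2 * (neighborsIn G U u).card) ≤ 1 / 2 := by
          rw [div_le_div_iff₀ (by positivity) (by norm_num)]
          linarith
        linarith
      have h1 := Finset.card_nsmul_le_sum _ _ _ hge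
      have h2 := hlt U hUne
      rw [nsmul_eq_mul] at h1
      linarith

end

/-! ### From infinitesimal rigidity to rigidity -/

section

variable {V : Type*} [DecidableEq V] {d : ℕ}

/-- The graph of all pairs whose row lies in the span of the rows of the edges of `G`. -/
def spanGraph (G : SimpleGraph V) (p : V → Fin d → ℝ) : SimpleGraph V where
  Adj x y := x ≠ y ∧ row p x y ∈ rowSpan p {e | G.Adj e.1 e.2}
  symm := ⟨fun x y h => ⟨h.1.symm, row_comm p x y ▸ h.2⟩⟩
  loopless := ⟨fun _ h => h.1 rfl⟩

theorem le_spanGraph (G : SimpleGraph V) (p : V → Fin d → ℝ) : G ≤ spanGraph G p :=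
  fun _ _ h => ⟨h.ne, row_mem_rowSpan p h⟩

theorem rowSpan_spanGraph_le (G : SimpleGraph V) (p : V → Fin d → ℝ) :
    rowSpan p {e | (spanGraph G p).Adj e.1 e.2} ≤ rowSpan p {e | G.Adj e.1 e.2} :=
  rowSpan_le.2 fun _ _ h => h.2

theorem continuous_row (x y : V) : Continuous fun p : V → Fin d → ℝ => row p x y :=
  ((continuous_single x).comp ((continuous_apply x).sub (continuous_apply y))).add
    ((continuous_single y).comp ((continuous_apply y).sub (continuous_apply x)))

variable [Fintype V]

/-- Generic frameworks of `d * (d + 1)`-connected graphs are infinitesimally rigid. -/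
theorem row_mem_rowSpan_of_isKConnected {G : SimpleGraph V} (hd : 1 ≤ d)
    (hG : IsKConnected G (d * (d + 1))) {p : V → Fin d → ℝ}
    (hp : AlgebraicIndependent ℚ fun x : V × Fin d => p x.1 x.2) (x y : V) :
    row p x y ∈ rowSpan p {e | G.Adj e.1 e.2} := by
  have hclosed : ∀ x y, x ≠ y → row p x y ∈ rowSpan p {e | (spanGraph G p).Adj e.1 e.2} →
      (spanGraph G p).Adj x y := fun x y hne h => ⟨hne, rowSpan_spanGraph_le G p h⟩
  have hmerge : HasCliqueMerging (spanGraph G p) d := fun C x y hC hcl hx hy hne =>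
    hclosed x y hne (row_mem_rowSpan_of_common_clique _ hp hC hcl hx hy hne)
  have hcut : HasNoSmallCut (spanGraph G p) (d * (d + 1)) Finset.univ :=
    IsKConnected.hasNoSmallCut ⟨hG.1, fun S hS =>
      (hG.2 S hS).mono (SimpleGraph.comap_monotone _ (le_spanGraph G p))⟩
  have hclique := hmerge.isClique hd (r := fun S => rigidityRank (spanGraph G p) p S)
    (Nat.cast_nonneg _)
    (fun S v hv => by exact_mod_cast rigidityRank_add_gain_le hp hd hclosed hv)
    (fun U hU => by exact_mod_cast rigidityRank_lt (spanGraph G p) p hd hU) hcut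
  by_cases hxy : x = y
  · rw [hxy, row_self]; exact zero_mem _
  · exact (hclique (by simp) (by simp) hxy).2

/-- The displacement from `p` to `q`, paired with a row at the midpoint of `p` and `q`, is half the
difference of the squared lengths. -/
theorem sum_mul_row_midpoint (P Q : V → EuclideanSpace ℝ (Fin d)) (x y : V) :
    ∑ v, ∑ i, (Q v i - P v i) * row (fun v i => (P v i + Q v i) / 2) x y v i =
      (‖Q x - Q y‖ ^ 2 - ‖P x - P y‖ ^ 2) / 2 := by
  have h : ∀ v, ∑ i, (Q v i - P v i) * row (fun v i => (P v i + Q v i) / 2) x y v i =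
      (if v = x then ∑ i, (Q x i - P x i) * ((P x i + Q x i) / 2 - (P y i + Q y i) / 2) else 0) +
      (if v = y then ∑ i, (Q y i - P y i) * ((P y i + Q y i) / 2 - (P x i + Q x i) / 2) else 0) := by
    intro v
    simp only [row, Pi.add_apply, Pi.single_apply, mul_add, Finset.sum_add_distrib]
    congr 1 <;> split_ifs with hv <;> simp [hv]
  rw [Finset.sum_congr rfl fun v _ => h v, Finset.sum_add_distrib]
  simp only [Finset.sum_ite_eq', Finset.mem_univ, if_true, EuclideanSpace.norm_sq_eq,
    ← Finset.sum_add_distrib, ← Finset.sum_sub_distrib, Finset.sum_div]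
  refine Finset.sum_congr rfl fun i _ => ?_
  simp only [PiLp.sub_apply, Real.norm_eq_abs, sq_abs]
  ring

/-- Infinitesimally rigid generic frameworks are rigid. If `q` is equivalent to `p` and close to
it, then `q - p` is an infinitesimal motion at the midpoint of `p` and `q`. There the edges of `G`
still have the largest rank possible, so every infinitesimal motion preserves all distances. -/
theorem isRigidFramework_of_row_mem_rowSpan {G : SimpleGraph V} {P : V → EuclideanSpace ℝ (Fin d)}
    (hP : IsGeneric P)
    (hG : ∀ x y, row (fun v i => P v i) x y ∈ rowSpan (fun v i => P v i) {e | G.Adj e.1 e.2}) :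
    IsRigidFramework G P := by
  let p : V → Fin d → ℝ := fun v i => P v i
  obtain ⟨κ, a, ha, hspan, hli⟩ :=
    exists_linearIndependent' ℝ fun e : {e : V × V | G.Adj e.1 e.2} => row p e.1.1 e.1.2
  have : Finite κ := Finite.of_injective a ha
  have hopen : IsOpen {m : V → Fin d → ℝ |
      LinearIndependent ℝ fun k => row m (a k).1.1 (a k).1.2} :=
    (isOpen_setOfPred_linearIndependent (𝕜 := ℝ) (ι := κ) (E := V → Fin d → ℝ)).preimage
      (continuous_pi fun k => continuous_row (a k).1.1 (a k).1.2)
  obtain ⟨ε, hε, hball⟩ := Metric.isOpen_iff.1 hopen p hli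
  refine ⟨ε, hε, fun Q hPQ hclose => ?_⟩
  let m : V → Fin d → ℝ := fun v i => (P v i + Q v i) / 2
  have hm : LinearIndependent ℝ fun k => row m (a k).1.1 (a k).1.2 := by
    refine hball ?_
    rw [Metric.mem_ball, dist_pi_lt_iff hε]
    intro v
    rw [dist_pi_lt_iff hε]
    intro i
    have h1 := (PiLp.norm_apply_le (P v - Q v) i).trans_lt (hclose v)
    rw [PiLp.sub_apply, Real.norm_eq_abs] at h1
    rw [Real.dist_eq, show m v i - p v i = -((P v i - Q v i) / 2) by simp only [m, p]; ring,
      abs_neg, abs_div, abs_two]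
    linarith [abs_nonneg (P v i - Q v i)]
  have hmem : ∀ x y, row m x y ∈
      Submodule.span ℝ (Set.range fun k => row m (a k).1.1 (a k).1.2) := by
    intro x y
    by_contra hnot
    -- Otherwise one more row would be independent at `m`, hence also at the generic `p`.
    have h1 := linearIndependent_row_of_generic (p := p) (q := m)
      (fun o : Option κ => o.elim (x, y) fun k => (a k).1) hP
      (linearIndependent_option.2 ⟨hm, hnot⟩)
    refine (linearIndependent_option.1 h1).2 ?_
    have h2 := hG x y
    rw [rowSpan, Set.image_eq_range, ← hspan] at h2
    exact h2
  let φ : (V → Fin d → ℝ) →ₗ[ℝ] ℝ :=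
    ∑ v, ∑ i, (Q v i - P v i) • ((LinearMap.proj i : (Fin d → ℝ) →ₗ[ℝ] ℝ).comp
      (LinearMap.proj v : (V → Fin d → ℝ) →ₗ[ℝ] Fin d → ℝ))
  have hφ : ∀ x y, φ (row m x y) = (‖Q x - Q y‖ ^ 2 - ‖P x - P y‖ ^ 2) / 2 := fun x y => by
    rw [← sum_mul_row_midpoint]
    simp [φ, m]
  have hker : Submodule.span ℝ (Set.range fun k => row m (a k).1.1 (a k).1.2) ≤ φ.ker := by
    rw [Submodule.span_le]
    rintro _ ⟨k, rfl⟩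
    rw [SetLike.mem_coe, LinearMap.mem_ker, hφ, hPQ _ _ (a k).2, sub_self, zero_div]
  intro x y
  have h := LinearMap.mem_ker.1 (hker (hmem x y))
  rw [hφ] at h
  exact (sq_eq_sq₀ (norm_nonneg _) (norm_nonneg _)).1 (by linarith)

end

end GraphRigidity

theorem theorem1 {V : Type*} [Fintype V] (G : SimpleGraph V) (d : ℕ) (hd : 1 ≤ d)
    (hG : GraphRigidity.IsKConnected G (d * (d + 1))) :
    GraphRigidity.IsRigid G d := by
  classical
  exact fun P hP => GraphRigidity.isRigidFramework_of_row_mem_rowSpan hP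
    (GraphRigidity.row_mem_rowSpan_of_isKConnected hd hG hP)
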